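/- For $\tau\in\mathbb C$ with $\operatorname{Im}\tau>0$ and $q=e^{\pi i\tau}$ let $\vartheta_k(z)=\vartheta_k(z|\tau)$, $k=1,2,3,4$, be the elliptic theta functions in the notation of Whittaker and Watson, so that $\vartheta_3(z)=\sum_{n\in\mathbb Z}q^{n^2}e^{2inz}$, $\vartheta_4(z)=\vartheta_3(z+\frac{\pi}{2})$, $\vartheta_1(z)=-ie^{iz+\pi i\tau/4}\vartheta_4(z+\frac{\pi\tau}{2})$, $\vartheta_2(z)=\vartheta_1(z+\frac{\pi}{2})$; write $\vartheta_k=\vartheta_k(0)$. For $\lambda_0\in\mathbb R$ put $$f(\alpha)=\frac{\vartheta_1(\alpha/2)}{\vartheta_2(\alpha/2)},\quad h(\alpha)=\frac{\vartheta_4((\alpha-\lambda_0)/2)}{\vartheta_3((\alpha-\lambda_0)/2)},\quad g(\alpha,\beta)=f(\alpha-\beta)h(\alpha)h(\beta),\quad g_0(\alpha)=-\frac{1}{\vartheta_3\vartheta_4}\cdot\frac{\vartheta_2'(\alpha/2)}{\vartheta_2(\alpha/2)}.$$ Let $G$ be a bipartite quad-graph rhombically embedded in $\mathbb C$ with unit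 edges. For a quad $(x_0,x_1,x_{12},x_2)$ of $G$ with black vertices $x_0,x_{12}$, let $e^{i\alpha}$ and $e^{i\beta}$ ($\alpha,\beta\in\mathbb R$) be the edges from $x_0$ to the white vertices $x_1$ and $x_2$, the quad being labelled so that $\alpha-\beta$ is, modulo $2\pi$, the interior angle $\phi\in(0,\pi)$ of the rhombus at its black vertices. For a real-valued function on the black vertices, with values at the vertices denoted by the same symbols as the vertices, consider the two Dirichlet energies $$S_g=\sum_{\text{quads}}\Big(\tfrac12 g(\alpha,\beta)x_0^2+\tfrac12 g(\alpha+\pi,\beta+\pi)x_{12}^2-f(\alpha-\beta)x_0x_{12}\Big),$$ $$S_{g_0}=\sum_{\text{quads}}\Big(\tfrac12 g_0(\alpha-\beta)(x_0^2+x_{12}^2)-f(\alpha-\beta)x_0x_{12}\Big).$$ Theorem. Let $\tau=i\tau_0$ with $\tau_0>0$ (the rectangular case). Then every quad contribution in $S_g$ and in $S_{g_0}$ is a real quadratic form in $(x_0,x_{12})$, and the following holds. (i) Every quad contribution in $S_g$ is a nonzero positive semidefinite form, namely a complete square with a positive coefficient: with $\kappa=h(\alpha)h(\beta)>0$ and $f(\alpha-\beta)>0$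 it equals $$\frac{f(\alpha-\beta)}{2\kappa}\,\big(\kappa x_0-x_{12}\big)^2 .$$ (ii) Every quad contribution in $S_{g_0}$ is a positive definite quadratic form. -/

import Mathlib

namespace IsoradialDirichlet

/-! Theta functions in the notation of Whittaker and Watson, with nome `q = exp (π i τ)`. -/

/-- `ϑ₃(z | τ) = ∑ₙ q ^ (n²) exp (2 i n z)`; Mathlib's `jacobiTheta₂` has the argument `z / π`. -/
noncomputable def theta3 (τ z : ℂ) : ℂ := jacobiTheta₂ (z / Real.pi) τ

/-- `ϑ₄(z | τ) = ϑ₃(z + π/2 | τ) = ∑ₙ (-1)ⁿ q ^ (n²) exp (2 i n z)`. -/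
noncomputable def theta4 (τ z : ℂ) : ℂ := theta3 τ (z + Real.pi / 2)

/-- `ϑ₁(z | τ) = -i exp (i z + π i τ / 4) ϑ₄(z + π τ / 2 | τ)
  = -i ∑ₙ (-1)ⁿ q ^ ((n + 1/2)²) exp ((2 n + 1) i z)`. -/
noncomputable def theta1 (τ z : ℂ) : ℂ :=
  -Complex.I * Complex.exp (Complex.I * z + Real.pi * Complex.I * τ / 4) *
    theta4 τ (z + Real.pi * τ / 2)

/-- `ϑ₂(z | τ) = ϑ₁(z + π/2 | τ) = ∑ₙ q ^ ((n + 1/2)²) exp ((2 n + 1) i z)`. -/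
noncomputable def theta2 (τ z : ℂ) : ℂ := theta1 τ (z + Real.pi / 2)

/-- `f(α) = ϑ₁(α/2) / ϑ₂(α/2)`. -/
noncomputable def f (τ α : ℂ) : ℂ := theta1 τ (α / 2) / theta2 τ (α / 2)

/-- `h(α; λ₀) = ϑ₄((α - λ₀)/2) / ϑ₃((α - λ₀)/2)`. -/
noncomputable def h (τ lam α : ℂ) : ℂ := theta4 τ ((α - lam) / 2) / theta3 τ ((α - lam) / 2)

/-- `g(α, β; λ₀) = f(α - β) h(α; λ₀) h(β; λ₀)`. -/
noncomputable def g (τ lam α β : ℂ) : ℂ := f τ (α - β) * h τ lam α * h τ lam β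

/-- `g₀(α) = -(1 / (ϑ₃(0) ϑ₄(0))) ϑ₂'(α/2) / ϑ₂(α/2)`, where `ϑ₂'` is the derivative of `ϑ₂`
in its argument. -/
noncomputable def g₀ (τ α : ℂ) : ℂ :=
  -(1 / (theta3 τ 0 * theta4 τ 0)) * (deriv (theta2 τ) (α / 2) / theta2 τ (α / 2))

/-- A labelled quad `(x₀, x₁, x₁₂, x₂)`, realised as a rhombus in `ℂ` with unit sides; `x₀`, `x₁₂`
are its black and `x₁`, `x₂` its white vertices. Edges are directed from black to white, and an
edge with label `α` is the vector `exp (i α)`. The condition `oriented` says that `α - β` is,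
modulo `2π`, the interior angle in `(0, π)` of the rhombus at its black vertices. -/
structure RhombicQuad where
  x₀ : ℂ
  x₁ : ℂ
  x₁₂ : ℂ
  x₂ : ℂ
  α : ℝ
  β : ℝ
  edge₀₁ : x₁ - x₀ = Complex.exp (Complex.I * α)
  edge₀₂ : x₂ - x₀ = Complex.exp (Complex.I * β)
  edge₁₂₁ : x₁ - x₁₂ = Complex.exp (Complex.I * (β + Real.pi))
  edge₁₂₂ : x₂ - x₁₂ = Complex.exp (Complex.I * (α + Real.pi))
  oriented : 0 < Real.sin (α - β)

namespace RhombicQuad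

/-- The four vertices of a quad. -/
def corners (q : RhombicQuad) : Set ℂ := {q.x₀, q.x₁, q.x₁₂, q.x₂}

/-- The closed rhombus bounded by a quad. -/
def region (q : RhombicQuad) : Set ℂ := convexHull ℝ q.corners

end RhombicQuad

/-- A bipartite quad-graph, rhombically embedded in `ℂ`, given by its faces: no point is both a
black and a white vertex, different faces do not overlap, and the faces meet edge to edge (a vertex
on a closed face is a corner of it). The set of faces may be infinite. -/
structure RhombicQuadGraph where
  faces : Set RhombicQuad
  bipartite : ∀ p ∈ faces, ∀ q ∈ faces,
    Disjoint ({p.x₀, p.x₁₂} : Set ℂ) ({q.x₁, q.x₂} : Set ℂ)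
  disjoint_faces : ∀ p ∈ faces, ∀ q ∈ faces, p ≠ q →
    Disjoint (interior p.region) (interior q.region)
  edge_to_edge : ∀ p ∈ faces, ∀ q ∈ faces, p.corners ∩ q.region ⊆ q.corners

/-- The contribution of the quad `q` to the Dirichlet energy built from `g` and `f`, for the values
`x`, `y` of the field at `x₀`, `x₁₂`. -/
noncomputable def gTerm (τ lam : ℂ) (q : RhombicQuad) (x y : ℂ) : ℂ :=
  1 / 2 * g τ lam q.α q.β * x ^ 2 + 1 / 2 * g τ lam (q.α + Real.pi) (q.β + Real.pi) * y ^ 2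
    - f τ (q.α - q.β) * x * y

/-- The contribution of the quad `q` to the Dirichlet energy built from `g₀` and `f`. -/
noncomputable def g₀Term (τ : ℂ) (q : RhombicQuad) (x y : ℂ) : ℂ :=
  1 / 2 * g₀ τ (q.α - q.β) * (x ^ 2 + y ^ 2) - f τ (q.α - q.β) * x * y

/-- The Dirichlet energy built from `g` and `f`, over a finite set of quads. -/
noncomputable def gEnergy (τ lam : ℂ) (F : Finset RhombicQuad) (x : ℂ → ℂ) : ℂ :=
  ∑ q ∈ F, gTerm τ lam q (x q.x₀) (x q.x₁₂)

/-- The Dirichlet energy built from `g₀` and `f`, over a finite set of quads. -/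
noncomputable def g₀Energy (τ : ℂ) (F : Finset RhombicQuad) (x : ℂ → ℂ) : ℂ :=
  ∑ q ∈ F, g₀Term τ q (x q.x₀) (x q.x₁₂)

end IsoradialDirichlet

/-!
For `τ = i t` the theta functions are real on the real line, and everything follows from Schröter's
identities, which rewrite a product of two theta functions with parameter `t` through theta
functions with parameter `2 t` (`theta3_mul_theta3`, `theta2_mul_theta2`).

*Signs.* Poisson summation gives `ϑ₃ > 0` (`Θ₃_pos`). Landen's transformation
`ϑ₂(x|t) ϑ₂(0|t) = 2 ϑ₂(x|2t) ϑ₃(x|2t)` shows that the sign of `ϑ₂(x|t)` is unchanged under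
`t ↦ 2 t`; as `t → ∞` it becomes the sign of `cos x` (`Θ₂_mul_cos_pos`). Hence `f > 0` and `h > 0`,
and since `h (α + π) = 1 / h α`, the contribution of a quad to the energy built from `g` is a
complete square.

*The inequality `f < g₀`.* Write `A = ϑ₂(·|2t)` and `B = ϑ₃(·|2t)`. Landen's transformation
expresses `ϑ₂' / ϑ₂` as `A' / A + B' / B`, and the Wronskian identity `wronskian_Θ₂_Θ₃` together with
Jacobi's formula `ϑ₁' = ϑ₂ ϑ₃ ϑ₄` (`neg_deriv_Θ₂_pi_div_two`) gives
`ϑ₃ ϑ₄ f = B' / B - A' / A`. So `ϑ₃ ϑ₄ (g₀ - f) = -2 B' / B`, and what remains is that `ϑ₃` is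
decreasing on `(0, π / 2)` (`deriv_Θ₃_neg_of_mem_Ioo`). There its logarithmic derivative vanishes
at both endpoints and is strictly midpoint convex in between (`two_mul_logDeriv_Θ₃_lt`), again by
Schröter's identity, so it is negative.
-/

namespace IsoradialDirichlet

open Filter Topology

/-! ### Fourier series -/

/-- The Fourier mode `exp (2 i μ z - π t μ²)` of a theta function with parameter `τ = i t`. The
series for `ϑ₃` runs over `μ ∈ ℤ`, the one for `ϑ₂` over `μ ∈ ℤ + 1/2`. -/
noncomputable def mode (t μ : ℝ) (z : ℂ) : ℂ :=
  Complex.exp (2 * Complex.I * μ * z - Real.pi * t * μ ^ 2)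

lemma im_I_mul_pos {t : ℝ} (ht : 0 < t) : 0 < (Complex.I * (t : ℂ)).im := by simpa using ht

lemma hasSum_theta3 {t : ℝ} (ht : 0 < t) (z : ℂ) :
    HasSum (fun n : ℤ => mode t n z) (theta3 (Complex.I * t) z) := by
  have hπ : (Real.pi : ℂ) ≠ 0 := by exact_mod_cast Real.pi_ne_zero
  refine (hasSum_jacobiTheta₂_term (z / Real.pi) (im_I_mul_pos ht)).congr_fun fun n => ?_
  rw [jacobiTheta₂_term, mode]
  congr 1
  push_cast
  field_simp
  linear_combination -(n : ℂ) ^ 2 * Real.pi * t * Complex.I_sq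

/-- `ϑ₂` as a half-period translate of Mathlib's theta function. -/
lemma theta2_eq (τ z : ℂ) :
    theta2 τ z = Complex.exp (Complex.I * z + Real.pi * Complex.I * τ / 4) *
      jacobiTheta₂ (z / Real.pi + τ / 2) τ := by
  have hπ : (Real.pi : ℂ) ≠ 0 := by exact_mod_cast Real.pi_ne_zero
  have h1 : Complex.exp (Complex.I * (z + Real.pi / 2) + Real.pi * Complex.I * τ / 4) =
      Complex.I * Complex.exp (Complex.I * z + Real.pi * Complex.I * τ / 4) := by
    rw [show Complex.I * (z + Real.pi / 2) + Real.pi * Complex.I * τ / 4 =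
      (Complex.I * z + Real.pi * Complex.I * τ / 4) + Real.pi / 2 * Complex.I by ring,
      Complex.exp_add, Complex.exp_pi_div_two_mul_I, mul_comm]
  have h2 : (z + Real.pi / 2 + Real.pi * τ / 2 + Real.pi / 2) / Real.pi =
      (z / Real.pi + τ / 2) + 1 := by
    field_simp
    ring
  rw [theta2, theta1, theta4, theta3, h1, h2, jacobiTheta₂_add_left]
  linear_combination -Complex.exp (Complex.I * z + Real.pi * Complex.I * τ / 4) *
      jacobiTheta₂ (z / Real.pi + τ / 2) τ * Complex.I_sq

lemma exp_mul_jacobiTheta₂_term (t : ℝ) (n : ℤ) (z : ℂ) :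
    Complex.exp (Complex.I * z + Real.pi * Complex.I * (Complex.I * t) / 4) *
      jacobiTheta₂_term n (z / Real.pi + Complex.I * t / 2) (Complex.I * t) =
      mode t (n + 1 / 2) z := by
  have hπ : (Real.pi : ℂ) ≠ 0 := by exact_mod_cast Real.pi_ne_zero
  rw [jacobiTheta₂_term, mode, ← Complex.exp_add]
  congr 1
  push_cast
  field_simp
  linear_combination 4 * ((n : ℂ) ^ 2 * 4 + 4 * n + 1) * Real.pi * t * Complex.I_sq

lemma hasSum_theta2 {t : ℝ} (ht : 0 < t) (z : ℂ) :
    HasSum (fun n : ℤ => mode t (n + 1 / 2) z) (theta2 (Complex.I * t) z) := by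
  rw [theta2_eq]
  refine ((hasSum_jacobiTheta₂_term (z / Real.pi + Complex.I * t / 2)
    (im_I_mul_pos ht)).mul_left _).congr_fun fun n => ?_
  rw [exp_mul_jacobiTheta₂_term]

lemma differentiable_theta3 {t : ℝ} (ht : 0 < t) :
    Differentiable ℂ (theta3 (Complex.I * t)) := fun z =>
  DifferentiableAt.comp (f := fun z : ℂ => z / Real.pi) z
    (differentiableAt_jacobiTheta₂_fst (z / Real.pi) (im_I_mul_pos ht))
    (differentiableAt_id.div_const (Real.pi : ℂ))

/-- Termwise differentiation of the series for `ϑ₂`. -/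
lemma hasDerivAt_theta2 {t : ℝ} (ht : 0 < t) (z : ℂ) :
    HasDerivAt (theta2 (Complex.I * t))
      (∑' n : ℤ, 2 * Complex.I * (n + 1 / 2) * mode t (n + 1 / 2) z) z := by
  have hπ : (Real.pi : ℂ) ≠ 0 := by exact_mod_cast Real.pi_ne_zero
  set w : ℂ := z / Real.pi + Complex.I * t / 2 with hw
  set e : ℂ := Complex.exp (Complex.I * z + Real.pi * Complex.I * (Complex.I * t) / 4) with he
  have hw' : HasDerivAt (fun z : ℂ => z / Real.pi + Complex.I * t / 2) (1 / Real.pi) z :=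
    ((hasDerivAt_id z).div_const _).add_const _
  have h1 := (hasDerivAt_jacobiTheta₂_fst w (im_I_mul_pos ht)).comp z hw'
  have he' : HasDerivAt (fun z : ℂ => Complex.exp (Complex.I * z +
      Real.pi * Complex.I * (Complex.I * t) / 4)) (e * (Complex.I * 1)) z :=
    (((hasDerivAt_id z).const_mul _).add_const _).cexp
  have h2 := he'.mul h1
  have hs := ((hasSum_jacobiTheta₂_term w (im_I_mul_pos ht)).mul_left (e * (Complex.I * 1))).add
    (((hasSum_jacobiTheta₂'_term w (im_I_mul_pos ht)).mul_right (1 / (Real.pi : ℂ))).mul_left e)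
  have hs' : HasSum (fun n : ℤ => 2 * Complex.I * (n + 1 / 2) * mode t (n + 1 / 2) z)
      (e * (Complex.I * 1) * jacobiTheta₂ w (Complex.I * t) +
        e * (jacobiTheta₂' w (Complex.I * t) * (1 / Real.pi))) := by
    refine hs.congr_fun fun n => ?_
    rw [← exp_mul_jacobiTheta₂_term, ← hw, ← he, jacobiTheta₂'_term]
    field_simp
    ring
  rw [hs'.tsum_eq]
  refine h2.congr_of_eventuallyEq (Filter.Eventually.of_forall fun z => ?_)
  rw [theta2_eq]
  rfl

lemma differentiable_theta2 {t : ℝ} (ht : 0 < t) :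
    Differentiable ℂ (theta2 (Complex.I * t)) := fun z => (hasDerivAt_theta2 ht z).differentiableAt

lemma theta3_neg (τ z : ℂ) : theta3 τ (-z) = theta3 τ z := by
  rw [theta3, neg_div, jacobiTheta₂_neg_left, theta3]

lemma theta3_add_pi (τ z : ℂ) : theta3 τ (z + Real.pi) = theta3 τ z := by
  have hπ : (Real.pi : ℂ) ≠ 0 := by exact_mod_cast Real.pi_ne_zero
  rw [theta3, add_div, div_self hπ, jacobiTheta₂_add_left, theta3]

lemma mode_neg (t μ : ℝ) (z : ℂ) : mode t μ (-z) = mode t (-μ) z := by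
  rw [mode, mode]
  push_cast
  congr 1
  ring

lemma conj_mode (t μ x : ℝ) : (starRingEnd ℂ) (mode t μ x) = mode t μ (-x) := by
  rw [mode, mode, ← Complex.exp_conj]
  simp [map_sub, map_mul, Complex.conj_ofNat]

lemma theta2_neg {t : ℝ} (ht : 0 < t) (z : ℂ) :
    theta2 (Complex.I * t) (-z) = theta2 (Complex.I * t) z := by
  refine (hasSum_theta2 ht (-z)).unique ?_
  refine ((Equiv.subLeft (-1 : ℤ)).hasSum_iff.mpr (hasSum_theta2 ht z)).congr_fun fun n => ?_
  rw [mode_neg, Function.comp_apply, Equiv.subLeft_apply]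
  congr 1
  push_cast
  ring

lemma theta2_add_pi (τ z : ℂ) : theta2 τ (z + Real.pi) = -theta2 τ z := by
  have hπ : (Real.pi : ℂ) ≠ 0 := by exact_mod_cast Real.pi_ne_zero
  rw [theta2_eq, theta2_eq, show Complex.I * (z + Real.pi) + Real.pi * Complex.I * τ / 4 =
    (Complex.I * z + Real.pi * Complex.I * τ / 4) + Real.pi * Complex.I by ring, Complex.exp_add,
    Complex.exp_pi_mul_I, show (z + Real.pi) / Real.pi + τ / 2 = z / Real.pi + τ / 2 + 1 by
      field_simp; ring, jacobiTheta₂_add_left]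
  ring

lemma conj_theta3 {t : ℝ} (ht : 0 < t) (x : ℝ) :
    (starRingEnd ℂ) (theta3 (Complex.I * t) x) = theta3 (Complex.I * t) x := by
  have h := Complex.hasSum_conj'.mpr (hasSum_theta3 ht (x : ℂ))
  simp only [conj_mode] at h
  rw [h.unique (hasSum_theta3 ht _), theta3_neg]

lemma conj_theta2 {t : ℝ} (ht : 0 < t) (x : ℝ) :
    (starRingEnd ℂ) (theta2 (Complex.I * t) x) = theta2 (Complex.I * t) x := by
  have h := Complex.hasSum_conj'.mpr (hasSum_theta2 ht (x : ℂ))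
  simp only [conj_mode] at h
  rw [h.unique (hasSum_theta2 ht _), theta2_neg ht]

/-! ### Schröter's identities -/

/-- In the coordinates `(μ ± ν) / 2` the quadratic form `μ² + ν²` is again diagonal, with `t`
doubled. -/
lemma mode_mul_mode (t μ ν : ℝ) (x y : ℂ) :
    mode t μ x * mode t ν y =
      mode (2 * t) ((μ + ν) / 2) (x + y) * mode (2 * t) ((μ - ν) / 2) (x - y) := by
  simp only [mode, ← Complex.exp_add]
  push_cast
  congr 1
  ring

/-- The bijection `(a, b) ↦ (a + b, a - b)`, `(a, b) ↦ (a + b, a - b - 1)` onto the pairs of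
integers of even, respectively odd, sum. -/
noncomputable def parityEquiv : (ℤ × ℤ) ⊕ (ℤ × ℤ) ≃ ℤ × ℤ :=
  Equiv.ofBijective
    (Sum.elim (fun p => (p.1 + p.2, p.1 - p.2)) (fun p => (p.1 + p.2, p.1 - p.2 - 1))) <| by
    constructor
    · rintro (⟨a, b⟩ | ⟨a, b⟩) (⟨c, d⟩ | ⟨c, d⟩) h <;>
        simp only [Sum.elim_inl, Sum.elim_inr, Prod.mk.injEq, Sum.inl.injEq, Sum.inr.injEq] at h ⊢ <;>
        omega
    · rintro ⟨m, n⟩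
      rcases Int.even_or_odd' (m + n) with ⟨k, hk | hk⟩
      · exact ⟨.inl (k, m - k), by simp; omega⟩
      · exact ⟨.inr (k + 1, m - k - 1), by simp; omega⟩

lemma hasSum_mul_hasSum {ι κ : Type*} {u : ι → ℂ} {v : κ → ℂ} {a b : ℂ} (hu : HasSum u a)
    (hv : HasSum v b) : HasSum (fun p : ι × κ => u p.1 * v p.2) (a * b) :=
  hu.mul hv (summable_mul_of_summable_norm hu.summable.norm hv.summable.norm)

/-- Splitting a double series over the lattice `ℤ²` into its even and odd sublattices. -/
lemma mul_eq_add_of_parity {u v p q p' q' : ℤ → ℂ} {U V P Q P' Q' : ℂ} (hu : HasSum u U)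
    (hv : HasSum v V) (hp : HasSum p P) (hq : HasSum q Q) (hp' : HasSum p' P') (hq' : HasSum q' Q')
    (heven : ∀ a b, u (a + b) * v (a - b) = p a * q b)
    (hodd : ∀ a b, u (a + b) * v (a - b - 1) = p' a * q' b) : U * V = P * Q + P' * Q' := by
  refine (parityEquiv.hasSum_iff.mpr (hasSum_mul_hasSum hu hv)).unique (HasSum.sum ?_ ?_)
  · exact (hasSum_mul_hasSum hp hq).congr_fun fun x => heven x.1 x.2
  · exact (hasSum_mul_hasSum hp' hq').congr_fun fun x => hodd x.1 x.2

lemma theta3_mul_theta3 {t : ℝ} (ht : 0 < t) (x y : ℂ) :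
    theta3 (Complex.I * t) x * theta3 (Complex.I * t) y =
      theta3 (Complex.I * (2 * t : ℝ)) (x + y) * theta3 (Complex.I * (2 * t : ℝ)) (x - y) +
        theta2 (Complex.I * (2 * t : ℝ)) (x + y) * theta2 (Complex.I * (2 * t : ℝ)) (x - y) := by
  have ht2 : 0 < 2 * t := by positivity
  refine mul_eq_add_of_parity (hasSum_theta3 ht x) (hasSum_theta3 ht y) (hasSum_theta3 ht2 _)
    (hasSum_theta3 ht2 _) ((Equiv.addRight (-1 : ℤ)).hasSum_iff.mpr (hasSum_theta2 ht2 _))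
    (hasSum_theta2 ht2 _) (fun a b => ?_) (fun a b => ?_)
  · rw [mode_mul_mode]
    congr 2 <;> push_cast <;> ring
  · rw [mode_mul_mode]
    simp only [Function.comp_apply, Equiv.coe_addRight]
    congr 2 <;> push_cast <;> ring

lemma theta2_mul_theta2 {t : ℝ} (ht : 0 < t) (x y : ℂ) :
    theta2 (Complex.I * t) x * theta2 (Complex.I * t) y =
      theta2 (Complex.I * (2 * t : ℝ)) (x + y) * theta3 (Complex.I * (2 * t : ℝ)) (x - y) +
        theta3 (Complex.I * (2 * t : ℝ)) (x + y) * theta2 (Complex.I * (2 * t : ℝ)) (x - y) := by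
  have ht2 : 0 < 2 * t := by positivity
  refine mul_eq_add_of_parity (hasSum_theta2 ht x) (hasSum_theta2 ht y) (hasSum_theta2 ht2 _)
    (hasSum_theta3 ht2 _) (hasSum_theta3 ht2 _) (hasSum_theta2 ht2 _)
    (fun a b => ?_) (fun a b => ?_)
  · rw [mode_mul_mode]
    congr 2 <;> push_cast <;> ring
  · rw [mode_mul_mode]
    congr 2 <;> push_cast <;> ring

/-! ### Degeneration as the nome tends to zero -/

/-- After rescaling by `exp (π t / 4)`, the modes of `ϑ₂` are dominated by those at `t = 1`. -/
lemma norm_exp_mul_mode_le {t : ℝ} (ht : 1 ≤ t) (n : ℤ) (x : ℝ) :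
    ‖(Real.exp (Real.pi * t / 4) : ℂ) * mode t (n + 1 / 2) x‖ ≤
      Real.exp (-(Real.pi * (n * (n + 1)))) := by
  have hn : (0 : ℝ) ≤ n * (n + 1) := by
    rcases lt_or_ge n 0 with h | h
    · have : (n : ℝ) + 1 ≤ 0 := by exact_mod_cast h
      nlinarith
    · have : (0 : ℝ) ≤ n := by exact_mod_cast h
      positivity
  rw [norm_mul, mode, Complex.norm_exp, Complex.norm_real, Real.norm_eq_abs, Real.abs_exp,
    ← Real.exp_add, Real.exp_le_exp]
  have : (2 * Complex.I * ((n + 1 / 2 : ℝ) : ℂ) * (x : ℂ) -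
      Real.pi * t * ((n + 1 / 2 : ℝ) : ℂ) ^ 2).re = -(Real.pi * t * (n + 1 / 2) ^ 2) := by
    rw [show (2 * Complex.I * ((n + 1 / 2 : ℝ) : ℂ) * (x : ℂ) -
      Real.pi * t * ((n + 1 / 2 : ℝ) : ℂ) ^ 2) = ((2 * (n + 1 / 2) * x : ℝ) : ℂ) * Complex.I +
        ((-(Real.pi * t * (n + 1 / 2) ^ 2) : ℝ) : ℂ) by push_cast; ring]
    simp only [Complex.add_re, Complex.re_ofReal_mul, Complex.I_re, mul_zero, zero_add,
      Complex.ofReal_re]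
  rw [this]
  nlinarith [mul_le_mul_of_nonneg_left ht (mul_nonneg Real.pi_pos.le hn)]

lemma summable_weighted_bound :
    Summable fun n : ℤ => (1 + 2 * |(n : ℝ)|) * Real.exp (-(Real.pi * (n * (n + 1)))) := by
  have h0 := summable_pow_mul_jacobiTheta₂_term_bound (1 / 2) one_pos 0
  have h1 := (summable_pow_mul_jacobiTheta₂_term_bound (1 / 2) one_pos 1).mul_left 2
  refine (h0.add h1).of_nonneg_of_le (fun n => by positivity) fun n => ?_
  have : -(Real.pi * (n * (n + 1))) ≤ -Real.pi * (1 * n ^ 2 - 2 * (1 / 2) * |(n : ℝ)|) := by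
    nlinarith [Real.pi_pos, neg_abs_le (n : ℝ)]
  have := Real.exp_le_exp.mpr this
  push_cast
  nlinarith [abs_nonneg (n : ℝ)]

lemma exp_mul_mode (t x : ℝ) (n : ℤ) :
    (Real.exp (Real.pi * t / 4) : ℂ) * mode t (n + 1 / 2) x =
      (Real.exp (-(Real.pi * (n * (n + 1))) * t) : ℂ) *
        Complex.exp ((2 * n + 1) * x * Complex.I) := by
  rw [mode, Complex.ofReal_exp, Complex.ofReal_exp, ← Complex.exp_add, ← Complex.exp_add]
  congr 1
  push_cast
  ring

lemma tendsto_exp_mul_mode {n : ℤ} (hn : n ≠ 0) (hn' : n ≠ -1) (x : ℝ) :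
    Tendsto (fun t : ℝ => (Real.exp (Real.pi * t / 4) : ℂ) * mode t (n + 1 / 2) x) atTop
      (𝓝 0) := by
  have hpos : (0 : ℝ) < n * (n + 1) := by
    rcases lt_or_ge n 0 with h | h
    · have h1 : (n : ℝ) < 0 := by exact_mod_cast h
      have h2 : (n : ℝ) + 1 < 0 := by exact_mod_cast (by omega : n + 1 < 0)
      exact mul_pos_of_neg_of_neg h1 h2
    · have h1 : (0 : ℝ) < n := by exact_mod_cast (by omega : 0 < n)
      positivity
  have h : Tendsto (fun t : ℝ => Real.exp (-(Real.pi * (n * (n + 1))) * t)) atTop (𝓝 0) :=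
    Real.tendsto_exp_atBot.comp
      (tendsto_id.const_mul_atTop_of_neg (neg_neg_of_pos (mul_pos Real.pi_pos hpos)))
  have h' := ((Complex.continuous_ofReal.tendsto 0).comp h).mul_const
    (Complex.exp ((2 * n + 1) * x * Complex.I))
  simp only [Complex.ofReal_zero, zero_mul] at h'
  exact h'.congr fun t => (exp_mul_mode t x n).symm

/-- As `t → ∞` only the two modes `± 1/2` survive in a rescaled weighted series. -/
lemma tendsto_tsum_mode {w : ℤ → ℂ} (hw : ∀ n : ℤ, ‖w n‖ ≤ 1 + 2 * |(n : ℝ)|) (x : ℝ) :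
    Tendsto (fun t : ℝ => (Real.exp (Real.pi * t / 4) : ℂ) * ∑' n : ℤ, w n * mode t (n + 1 / 2) x)
      atTop (𝓝 (w 0 * Complex.exp (x * Complex.I) + w (-1) * Complex.exp (-x * Complex.I))) := by
  set G : ℤ → ℂ := fun n => if n = 0 then w 0 * Complex.exp (x * Complex.I) else
    if n = -1 then w (-1) * Complex.exp (-x * Complex.I) else 0 with hG
  have hsum : ∑' n, G n =
      w 0 * Complex.exp (x * Complex.I) + w (-1) * Complex.exp (-x * Complex.I) := by
    rw [tsum_eq_sum (s := {0, -1}) (fun n hn => ?_), Finset.sum_pair (by norm_num)]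
    · simp [hG]
    · simp only [Finset.mem_insert, Finset.mem_singleton, not_or] at hn
      simp [hG, hn.1, hn.2]
  rw [← hsum]
  have key := tendsto_tsum_of_dominated_convergence (𝓕 := atTop) (g := G)
    (f := fun (t : ℝ) (n : ℤ) => w n * ((Real.exp (Real.pi * t / 4) : ℂ) * mode t (n + 1 / 2) x))
    summable_weighted_bound (fun n => ?_) ?_
  · refine key.congr fun t => ?_
    rw [← tsum_mul_left]
    exact tsum_congr fun n => by ring
  · by_cases h0 : n = 0
    · subst h0
      refine tendsto_const_nhds.congr fun t => ?_
      rw [exp_mul_mode]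
      simp [hG]
    by_cases h1 : n = -1
    · subst h1
      refine tendsto_const_nhds.congr fun t => ?_
      rw [exp_mul_mode]
      simp [hG]
      norm_num
    · have := (tendsto_exp_mul_mode h0 h1 x).const_mul (w n)
      simpa [hG, h0, h1] using this
  · filter_upwards [eventually_ge_atTop 1] with t ht n
    rw [norm_mul]
    exact mul_le_mul (hw n) (norm_exp_mul_mode_le ht n x) (norm_nonneg _) (by positivity)

lemma tendsto_exp_mul_theta2 (x : ℝ) :
    Tendsto (fun t : ℝ => (Real.exp (Real.pi * t / 4) : ℂ) * theta2 (Complex.I * t) x) atTop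
      (𝓝 (2 * Real.cos x : ℝ)) := by
  have h := tendsto_tsum_mode (w := fun _ => 1) (fun n => by simp) x
  have hl : (1 : ℂ) * Complex.exp (x * Complex.I) + 1 * Complex.exp (-x * Complex.I) =
      ((2 * Real.cos x : ℝ) : ℂ) := by
    push_cast
    rw [Complex.two_cos]
    ring
  rw [hl] at h
  refine h.congr' ?_
  filter_upwards [eventually_gt_atTop 0] with t ht
  simp only [one_mul]
  rw [(hasSum_theta2 ht x).tsum_eq]

lemma tendsto_exp_mul_deriv_theta2 (x : ℝ) :
    Tendsto (fun t : ℝ => (Real.exp (Real.pi * t / 4) : ℂ) * deriv (theta2 (Complex.I * t)) x) atTop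
      (𝓝 (-(2 * Real.sin x) : ℝ)) := by
  have h := tendsto_tsum_mode (w := fun n => 2 * Complex.I * (n + 1 / 2)) (fun n => ?_) x
  · have hl : 2 * Complex.I * (((0 : ℤ) : ℂ) + 1 / 2) * Complex.exp (x * Complex.I) +
        2 * Complex.I * (((-1 : ℤ) : ℂ) + 1 / 2) * Complex.exp (-x * Complex.I) =
        ((-(2 * Real.sin x) : ℝ) : ℂ) := by
      push_cast
      rw [Complex.two_sin]
      ring
    rw [hl] at h
    refine h.congr' ?_
    filter_upwards [eventually_gt_atTop 0] with t ht
    rw [(hasDerivAt_theta2 ht x).deriv]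
  · rw [show 2 * Complex.I * ((n : ℂ) + 1 / 2) = ((1 + 2 * n : ℝ) : ℂ) * Complex.I by
      push_cast; ring, norm_mul, Complex.norm_I, mul_one, Complex.norm_real, Real.norm_eq_abs]
    refine (abs_add_le _ _).trans ?_
    rw [abs_one, abs_mul, abs_two]

lemma tendsto_theta3 (x : ℝ) :
    Tendsto (fun t : ℝ => theta3 (Complex.I * t) x) atTop (𝓝 1) := by
  have hsum : ∑' n : ℤ, (if n = 0 then (1 : ℂ) else 0) = 1 := tsum_ite_eq 0 _
  rw [← hsum]
  have hb := summable_pow_mul_jacobiTheta₂_term_bound 0 one_pos 0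
  have hnorm (t : ℝ) (n : ℤ) : ‖mode t n x‖ = Real.exp (-(Real.pi * n ^ 2) * t) := by
    rw [mode, Complex.norm_exp, show (2 * Complex.I * ((n : ℝ) : ℂ) * (x : ℂ) -
      Real.pi * t * ((n : ℝ) : ℂ) ^ 2) = ((2 * n * x : ℝ) : ℂ) * Complex.I +
        ((-(Real.pi * n ^ 2) * t : ℝ) : ℂ) by push_cast; ring]
    simp only [Complex.add_re, Complex.re_ofReal_mul, Complex.I_re, mul_zero, zero_add,
      Complex.ofReal_re]
  refine (tendsto_tsum_of_dominated_convergence (𝓕 := atTop)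
    (f := fun (t : ℝ) (n : ℤ) => mode t n x) hb (fun n => ?_) ?_).congr' ?_
  · by_cases h0 : n = 0
    · subst h0
      simp [mode]
    · rw [if_neg h0, tendsto_zero_iff_norm_tendsto_zero]
      simp only [hnorm]
      have : (0 : ℝ) < n ^ 2 := by positivity
      exact Real.tendsto_exp_atBot.comp
        (tendsto_id.const_mul_atTop_of_neg (neg_neg_of_pos (mul_pos Real.pi_pos this)))
  · filter_upwards [eventually_ge_atTop 1] with t ht n
    rw [hnorm, pow_zero, one_mul, Real.exp_le_exp]
    nlinarith [mul_le_mul_of_nonneg_left ht (mul_nonneg Real.pi_pos.le (sq_nonneg (n : ℝ)))]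
  · filter_upwards [eventually_gt_atTop 0] with t ht
    exact (hasSum_theta3 ht x).tsum_eq

/-! ### Theta functions on the real line -/

/-- `ϑ₃(x | i t)` as a real function of real `x`. -/
noncomputable def Θ₃ (t x : ℝ) : ℝ := (theta3 (Complex.I * t) x).re

/-- `ϑ₂(x | i t)` as a real function of real `x`. -/
noncomputable def Θ₂ (t x : ℝ) : ℝ := (theta2 (Complex.I * t) x).re

section Real

variable {t : ℝ}

lemma ofReal_Θ₃ (ht : 0 < t) (x : ℝ) : (Θ₃ t x : ℂ) = theta3 (Complex.I * t) x :=
  Complex.conj_eq_iff_re.mp (conj_theta3 ht x)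

lemma ofReal_Θ₂ (ht : 0 < t) (x : ℝ) : (Θ₂ t x : ℂ) = theta2 (Complex.I * t) x :=
  Complex.conj_eq_iff_re.mp (conj_theta2 ht x)

lemma differentiable_Θ₃ (ht : 0 < t) : Differentiable ℝ (Θ₃ t) := fun x =>
  (differentiable_theta3 ht x).hasDerivAt.real_of_complex.differentiableAt

lemma differentiable_Θ₂ (ht : 0 < t) : Differentiable ℝ (Θ₂ t) := fun x =>
  (differentiable_theta2 ht x).hasDerivAt.real_of_complex.differentiableAt

lemma ofReal_deriv_Θ₂ (ht : 0 < t) (x : ℝ) :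
    ((deriv (Θ₂ t) x : ℝ) : ℂ) = deriv (theta2 (Complex.I * t)) x := by
  have h := (differentiable_Θ₂ ht x).hasDerivAt.ofReal_comp
  simp only [ofReal_Θ₂ ht] at h
  exact h.unique (differentiable_theta2 ht x).hasDerivAt.comp_ofReal

lemma continuous_deriv_Θ₃ (ht : 0 < t) : Continuous (deriv (Θ₃ t)) := by
  have h (x : ℝ) : deriv (Θ₃ t) x = (deriv (theta3 (Complex.I * t)) x).re :=
    (differentiable_theta3 ht x).hasDerivAt.real_of_complex.deriv
  rw [funext h]
  have hc : Continuous (deriv (theta3 (Complex.I * t))) :=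
    ((differentiable_theta3 ht).contDiff (n := 1)).continuous_deriv le_rfl
  exact Complex.continuous_re.comp (hc.comp Complex.continuous_ofReal)

lemma Θ₃_neg (t x : ℝ) : Θ₃ t (-x) = Θ₃ t x := by
  rw [Θ₃, Complex.ofReal_neg, theta3_neg, Θ₃]

lemma Θ₂_neg (ht : 0 < t) (x : ℝ) : Θ₂ t (-x) = Θ₂ t x := by
  rw [Θ₂, Complex.ofReal_neg, theta2_neg ht, Θ₂]

lemma Θ₃_add_pi (t x : ℝ) : Θ₃ t (x + Real.pi) = Θ₃ t x := by
  rw [Θ₃, Complex.ofReal_add, theta3_add_pi, Θ₃]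

lemma Θ₂_add_pi (t x : ℝ) : Θ₂ t (x + Real.pi) = -Θ₂ t x := by
  rw [Θ₂, Complex.ofReal_add, theta2_add_pi, Complex.neg_re, Θ₂]

lemma Θ₂_add_pi_div_two (t x : ℝ) : Θ₂ t (x + Real.pi / 2) = -Θ₂ t (x - Real.pi / 2) := by
  rw [← Θ₂_add_pi]
  ring_nf

lemma Θ₂_pi_div_two (ht : 0 < t) : Θ₂ t (Real.pi / 2) = 0 := by
  have h := Θ₂_add_pi_div_two t 0
  rw [zero_add, zero_sub, Θ₂_neg ht] at h
  linarith

lemma deriv_Θ₂_zero (ht : 0 < t) : deriv (Θ₂ t) 0 = 0 := by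
  have h : deriv (fun x => Θ₂ t (-x)) 0 = -deriv (Θ₂ t) (-0) := deriv_comp_neg _ _
  simp only [Θ₂_neg ht, neg_zero] at h
  have h' : deriv (fun x => Θ₂ t x) 0 = deriv (Θ₂ t) 0 := rfl
  linarith

lemma deriv_Θ₃_zero (t : ℝ) : deriv (Θ₃ t) 0 = 0 := by
  have h : deriv (fun x => Θ₃ t (-x)) 0 = -deriv (Θ₃ t) (-0) := deriv_comp_neg _ _
  simp only [Θ₃_neg, neg_zero] at h
  have h' : deriv (fun x => Θ₃ t x) 0 = deriv (Θ₃ t) 0 := rfl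
  linarith

lemma deriv_Θ₃_pi_div_two (t : ℝ) : deriv (Θ₃ t) (Real.pi / 2) = 0 := by
  have h : deriv (fun x => Θ₃ t (Real.pi - x)) (Real.pi / 2) =
      -deriv (Θ₃ t) (Real.pi - Real.pi / 2) := deriv_comp_const_sub _ _ _
  have h0 (x : ℝ) : Θ₃ t (Real.pi - x) = Θ₃ t x := by
    rw [← Θ₃_neg t x, ← Θ₃_add_pi t (-x), neg_add_eq_sub]
  simp only [h0, sub_half] at h
  have h' : deriv (fun x => Θ₃ t x) (Real.pi / 2) = deriv (Θ₃ t) (Real.pi / 2) := rfl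
  linarith

lemma Θ₃_mul_Θ₃ (ht : 0 < t) (x y : ℝ) :
    Θ₃ t x * Θ₃ t y = Θ₃ (2 * t) (x + y) * Θ₃ (2 * t) (x - y) +
      Θ₂ (2 * t) (x + y) * Θ₂ (2 * t) (x - y) := by
  have ht2 : 0 < 2 * t := by positivity
  apply Complex.ofReal_injective
  simp only [Complex.ofReal_add, Complex.ofReal_mul, ofReal_Θ₃ ht, ofReal_Θ₃ ht2, ofReal_Θ₂ ht2]
  simpa using theta3_mul_theta3 ht x y

lemma Θ₂_mul_Θ₂ (ht : 0 < t) (x y : ℝ) :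
    Θ₂ t x * Θ₂ t y = Θ₂ (2 * t) (x + y) * Θ₃ (2 * t) (x - y) +
      Θ₃ (2 * t) (x + y) * Θ₂ (2 * t) (x - y) := by
  have ht2 : 0 < 2 * t := by positivity
  apply Complex.ofReal_injective
  simp only [Complex.ofReal_add, Complex.ofReal_mul, ofReal_Θ₂ ht, ofReal_Θ₃ ht2, ofReal_Θ₂ ht2]
  simpa using theta2_mul_theta2 ht x y

/-- Shifting both arguments by `π / 2` changes the sign of one of the two terms in `Θ₂_mul_Θ₂`, which
isolates the other. -/
lemma two_mul_Θ₃_mul_Θ₂ (ht : 0 < t) (x y : ℝ) :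
    2 * Θ₃ (2 * t) (x + y) * Θ₂ (2 * t) (x - y) =
      Θ₂ t x * Θ₂ t y + Θ₂ t (x + Real.pi / 2) * Θ₂ t (y + Real.pi / 2) := by
  rw [Θ₂_mul_Θ₂ ht, Θ₂_mul_Θ₂ ht,
    show x + Real.pi / 2 + (y + Real.pi / 2) = x + y + Real.pi by ring, Θ₂_add_pi, Θ₃_add_pi,
    add_sub_add_right_eq_sub]
  ring

/-- Landen's transformation. -/
lemma Θ₂_mul_Θ₂_zero (ht : 0 < t) (x : ℝ) :
    Θ₂ t x * Θ₂ t 0 = 2 * (Θ₂ (2 * t) x * Θ₃ (2 * t) x) := by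
  rw [Θ₂_mul_Θ₂ ht, add_zero, sub_zero]
  ring

/-- The Wronskian of the two factors of `ϑ₂` in Landen's transformation. -/
lemma wronskian_Θ₂_Θ₃ (ht : 0 < t) (x : ℝ) :
    2 * (Θ₂ (2 * t) x * deriv (Θ₃ (2 * t)) x - deriv (Θ₂ (2 * t)) x * Θ₃ (2 * t) x) =
      -deriv (Θ₂ t) (Real.pi / 2) * Θ₂ t (x - Real.pi / 2) := by
  have ht2 : 0 < 2 * t := by positivity
  have h3 : HasDerivAt (fun y => Θ₃ (2 * t) (x + y)) (deriv (Θ₃ (2 * t)) x) 0 :=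
    HasDerivAt.comp_const_add x 0 (by simpa using (differentiable_Θ₃ ht2 x).hasDerivAt)
  have h2 : HasDerivAt (fun y => Θ₂ (2 * t) (x - y)) (-deriv (Θ₂ (2 * t)) x) 0 :=
    HasDerivAt.comp_const_sub x 0 (by simpa using (differentiable_Θ₂ ht2 x).hasDerivAt)
  -- both sides of `two_mul_Θ₃_mul_Θ₂` are differentiated in `y` at `y = 0`
  have hl := (h3.const_mul 2).mul h2
  have h0 : HasDerivAt (Θ₂ t) 0 0 := by
    simpa only [deriv_Θ₂_zero ht] using (differentiable_Θ₂ ht 0).hasDerivAt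
  have h1 : HasDerivAt (fun y => Θ₂ t (y + Real.pi / 2)) (deriv (Θ₂ t) (Real.pi / 2)) 0 :=
    HasDerivAt.comp_add_const 0 _ (by simpa using (differentiable_Θ₂ ht _).hasDerivAt)
  have hr := (h0.const_mul (Θ₂ t x)).add (h1.const_mul (Θ₂ t (x + Real.pi / 2)))
  have := hl.unique (hr.congr_of_eventuallyEq
    (Eventually.of_forall fun y => two_mul_Θ₃_mul_Θ₂ ht x y))
  rw [Θ₂_add_pi_div_two] at this
  simp only [add_zero, sub_zero] at this
  linarith

/-! ### Signs on the real line -/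

lemma re_pos_of_hasSum {u : ℤ → ℂ} {z : ℂ} (h : HasSum u z) (hu : ∀ n, 0 < (u n).re) :
    0 < z.re := by
  have h' := Complex.hasSum_re h
  rw [← h'.tsum_eq]
  exact h'.summable.tsum_pos (fun n => (hu n).le) 0 (hu 0)

lemma Θ₂_zero_pos (ht : 0 < t) : 0 < Θ₂ t 0 := by
  refine re_pos_of_hasSum (hasSum_theta2 ht _) fun n => ?_
  rw [mode, Complex.ofReal_zero, mul_zero, zero_sub]
  norm_cast
  exact Real.exp_pos _

/-- Poisson summation turns the series for `ϑ₃` into a sum of Gaussians. -/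
lemma Θ₃_pos (ht : 0 < t) (x : ℝ) : 0 < Θ₃ t x := by
  have htC : (t : ℂ) ≠ 0 := by exact_mod_cast ht.ne'
  have hτ : -1 / (Complex.I * t) = Complex.I * (t⁻¹ : ℝ) := by
    push_cast
    field_simp
    simp
  have hI : -Complex.I * (Complex.I * t) = ((t : ℝ) : ℂ) := by
    linear_combination -(t : ℂ) * Complex.I_sq
  have hpre : 1 / (-Complex.I * (Complex.I * t)) ^ (1 / 2 : ℂ) = ((t ^ (1 / 2 : ℝ))⁻¹ : ℝ) := by
    rw [hI, show (1 / 2 : ℂ) = ((1 / 2 : ℝ) : ℂ) by push_cast; rfl, ← Complex.ofReal_cpow ht.le]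
    push_cast
    rw [one_div]
  have hexp : Complex.exp (-Real.pi * Complex.I * (x / Real.pi) ^ 2 / (Complex.I * t)) =
      (Real.exp (-Real.pi * (x / Real.pi) ^ 2 / t) : ℝ) := by
    push_cast
    congr 1
    field_simp
  rw [Θ₃, theta3, jacobiTheta₂_functional_equation, hpre, hexp, mul_assoc, Complex.re_ofReal_mul,
    Complex.re_ofReal_mul, hτ]
  refine mul_pos (by positivity) (mul_pos (Real.exp_pos _)
    (re_pos_of_hasSum (hasSum_jacobiTheta₂_term _ (im_I_mul_pos (inv_pos.mpr ht))) fun n => ?_))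
  have : jacobiTheta₂_term n (x / Real.pi / (Complex.I * t)) (Complex.I * (t⁻¹ : ℝ)) =
      (Real.exp (2 * n * x / t - Real.pi * n ^ 2 / t) : ℝ) := by
    have hπ : (Real.pi : ℂ) ≠ 0 := by exact_mod_cast Real.pi_ne_zero
    rw [jacobiTheta₂_term]
    push_cast
    congr 1
    field_simp
    linear_combination Real.pi * (n : ℂ) ^ 2 * Complex.I_sq
  rw [this, Complex.ofReal_re]
  exact Real.exp_pos _

lemma tendsto_two_pow_mul (ht : 0 < t) : Tendsto (fun n : ℕ => 2 ^ n * t) atTop atTop :=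
  (tendsto_pow_atTop_atTop_of_one_lt one_lt_two).atTop_mul_const ht

lemma tendsto_exp_mul_Θ₂ (x : ℝ) :
    Tendsto (fun t : ℝ => Real.exp (Real.pi * t / 4) * Θ₂ t x) atTop (𝓝 (2 * Real.cos x)) := by
  have h := (Complex.continuous_re.tendsto _).comp (tendsto_exp_mul_theta2 x)
  rw [Complex.ofReal_re] at h
  exact h.congr fun t => Complex.re_ofReal_mul _ _

/-- Landen's transformation preserves the sign of `ϑ₂`, so that it is the one for small nome. -/
lemma Θ₂_mul_cos_pos (ht : 0 < t) {x : ℝ} (hx : Real.cos x ≠ 0) : 0 < Θ₂ t x * Real.cos x := by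
  have hstep {s : ℝ} (hs : 0 < s) (h : 0 < Θ₂ (2 * s) x * Real.cos x) :
      0 < Θ₂ s x * Real.cos x := by
    have h0 := Θ₂_zero_pos hs
    have h3 := Θ₃_pos (by positivity : 0 < 2 * s) x
    have : Θ₂ s x * Real.cos x * Θ₂ s 0 = 2 * (Θ₂ (2 * s) x * Real.cos x) * Θ₃ (2 * s) x := by
      linear_combination Real.cos x * Θ₂_mul_Θ₂_zero hs x
    exact pos_of_mul_pos_left (this ▸ by positivity) h0.le
  have hdown (n : ℕ) : 0 < Θ₂ (2 ^ n * t) x * Real.cos x → 0 < Θ₂ t x * Real.cos x := by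
    induction n with
    | zero => simp
    | succ n ih =>
      intro h
      exact ih (hstep (by positivity) (by rwa [pow_succ', mul_assoc] at h))
  have hlim := ((tendsto_exp_mul_Θ₂ x).comp (tendsto_two_pow_mul ht)).mul_const (Real.cos x)
  have hpos : 0 < 2 * Real.cos x * Real.cos x := by
    rw [mul_assoc]
    exact mul_pos two_pos (mul_self_pos.mpr hx)
  obtain ⟨n, hn⟩ := (hlim.eventually (lt_mem_nhds hpos)).exists
  rw [Function.comp_apply, mul_assoc] at hn
  exact hdown n (pos_of_mul_pos_right hn (Real.exp_pos _).le)

lemma Θ₂_sub_pi_div_two_mul_sin_pos (ht : 0 < t) {x : ℝ} (hx : Real.sin x ≠ 0) :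
    0 < Θ₂ t (x - Real.pi / 2) * Real.sin x := by
  rw [← Real.cos_sub_pi_div_two] at hx ⊢
  exact Θ₂_mul_cos_pos ht hx

/-! ### Jacobi's derivative formula -/

/-- Jacobi's formula `ϑ₁' = ϑ₂ ϑ₃ ϑ₄` at the origin. The ratio of the two sides is invariant under
`t ↦ 2 t` by Landen's transformation, and tends to `1` as `t → ∞`. -/
lemma neg_deriv_Θ₂_pi_div_two (ht : 0 < t) :
    -deriv (Θ₂ t) (Real.pi / 2) = Θ₂ t 0 * (Θ₃ t 0 * Θ₃ t (Real.pi / 2)) := by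
  set R : ℝ → ℝ := fun t =>
    -deriv (Θ₂ t) (Real.pi / 2) / (Θ₂ t 0 * (Θ₃ t 0 * Θ₃ t (Real.pi / 2))) with hR
  have hstep {s : ℝ} (hs : 0 < s) : R (2 * s) = R s := by
    have hs2 : 0 < 2 * s := by positivity
    have e1 := wronskian_Θ₂_Θ₃ hs (Real.pi / 2)
    rw [Θ₂_pi_div_two hs2, sub_self] at e1
    have e2 := Θ₂_mul_Θ₂_zero hs 0
    have e3 := Θ₃_mul_Θ₃ hs 0 (Real.pi / 2)
    rw [zero_add, zero_sub, Θ₃_neg, Θ₂_pi_div_two hs2, zero_mul, add_zero] at e3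
    have p1 := Θ₂_zero_pos hs
    have p2 := Θ₂_zero_pos hs2
    have p3 := Θ₃_pos hs2 0
    have p4 := Θ₃_pos hs2 (Real.pi / 2)
    simp only [hR]
    rw [e3, div_eq_div_iff (by positivity) (by positivity)]
    have p1' := p1.ne'
    apply mul_left_cancel₀ p1'
    linear_combination (1 / 2 * Θ₃ (2 * s) (Real.pi / 2) * Θ₂ s 0 ^ 2) * e1 +
      (-1 / 2 * Θ₃ (2 * s) (Real.pi / 2) * Θ₂ s 0 * deriv (Θ₂ s) (Real.pi / 2)) * e2
  have hiter (n : ℕ) : R (2 ^ n * t) = R t := by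
    induction n with
    | zero => simp
    | succ n ih => rw [pow_succ', mul_assoc, hstep (by positivity), ih]
  have l3 (x : ℝ) : Tendsto (fun t => Θ₃ t x) atTop (𝓝 1) :=
    (Complex.continuous_re.tendsto _).comp (tendsto_theta3 x)
  have l2 := tendsto_exp_mul_Θ₂ 0
  have ld : Tendsto (fun t : ℝ => Real.exp (Real.pi * t / 4) * deriv (Θ₂ t) (Real.pi / 2)) atTop
      (𝓝 (-(2 * Real.sin (Real.pi / 2)))) := by
    have h := (Complex.continuous_re.tendsto _).comp (tendsto_exp_mul_deriv_theta2 (Real.pi / 2))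
    rw [Complex.ofReal_re] at h
    refine h.congr' ?_
    filter_upwards [eventually_gt_atTop 0] with t ht
    rw [Function.comp_apply, ← ofReal_deriv_Θ₂ ht, Complex.re_ofReal_mul, Complex.ofReal_re]
  rw [Real.sin_pi_div_two, mul_one] at ld
  rw [Real.cos_zero, mul_one] at l2
  have hlim : Tendsto R atTop (𝓝 1) := by
    have h := ld.neg.div (l2.mul ((l3 0).mul (l3 (Real.pi / 2)))) (by norm_num)
    rw [show - -(2 : ℝ) / (2 * (1 * 1)) = 1 by norm_num] at h
    refine h.congr fun t => ?_
    simp only [hR, Pi.div_apply]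
    rw [← mul_neg, mul_assoc, mul_div_mul_left _ _ (Real.exp_ne_zero _)]
  have h1 : R t = 1 := tendsto_nhds_unique
    (tendsto_const_nhds.congr fun n => (hiter n).symm) (hlim.comp (tendsto_two_pow_mul ht))
  have p1 := Θ₂_zero_pos ht
  have p3 := Θ₃_pos ht 0
  have p4 := Θ₃_pos ht (Real.pi / 2)
  exact (div_eq_one_iff_eq (by positivity)).mp h1

end Real

/-! ### Monotonicity of `ϑ₃` -/

/-- Maximum principle: a continuous function on `[a, b]`, not positive at the endpoints, which is
strictly midpoint convex inside is negative inside. -/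
lemma neg_of_midpoint_convex {a b : ℝ} {u : ℝ → ℝ} (hu : ContinuousOn u (Set.Icc a b))
    (ha : u a ≤ 0) (hb : u b ≤ 0)
    (hconv : ∀ x d, 0 < d → a ≤ x - d → x + d ≤ b → 2 * u x < u (x + d) + u (x - d))
    {x : ℝ} (hx : x ∈ Set.Ioo a b) : u x < 0 := by
  -- an interior maximum contradicts convexity on the largest centred interval inside `[a, b]`
  have hmax {z : ℝ} (hz : z ∈ Set.Ioo a b) : ¬ ∀ y ∈ Set.Icc a b, u y ≤ u z := by
    intro h
    have hd : 0 < min (z - a) (b - z) := lt_min (sub_pos.mpr hz.1) (sub_pos.mpr hz.2)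
    have h1 := min_le_left (z - a) (b - z)
    have h2 := min_le_right (z - a) (b - z)
    have := hconv z _ hd (by linarith) (by linarith)
    linarith [h (z + min (z - a) (b - z)) ⟨by linarith, by linarith⟩,
      h (z - min (z - a) (b - z)) ⟨by linarith, by linarith⟩]
  by_contra! hx0
  obtain ⟨z, hz, hzmax⟩ := isCompact_Icc.exists_isMaxOn ⟨x, Set.Ioo_subset_Icc_self hx⟩ hu
  by_cases hz' : z ∈ Set.Ioo a b
  · exact hmax hz' fun y hy => hzmax hy
  · have hz0 : u z ≤ 0 := by
      rcases eq_or_lt_of_le hz.1 with h | h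
      · rwa [← h]
      rcases eq_or_lt_of_le hz.2 with h' | h'
      · rwa [h']
      · exact absurd ⟨h, h'⟩ hz'
    exact hmax hx fun y hy => (hzmax hy).trans (hz0.trans hx0)

section Real

variable {t : ℝ}

lemma wronskian_Θ₂_Θ₃_pos (ht : 0 < t) {x : ℝ} (hx : x ∈ Set.Ioo 0 Real.pi) :
    0 < Θ₂ (2 * t) x * deriv (Θ₃ (2 * t)) x - deriv (Θ₂ (2 * t)) x * Θ₃ (2 * t) x := by
  have hsin := Real.sin_pos_of_mem_Ioo hx
  have h1 := pos_of_mul_pos_left (Θ₂_sub_pi_div_two_mul_sin_pos ht hsin.ne') hsin.le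
  have h := wronskian_Θ₂_Θ₃ ht x
  rw [neg_deriv_Θ₂_pi_div_two ht] at h
  have p1 := Θ₂_zero_pos ht
  have p3 := Θ₃_pos ht 0
  have p4 := Θ₃_pos ht (Real.pi / 2)
  have : 0 < Θ₂ t 0 * (Θ₃ t 0 * Θ₃ t (Real.pi / 2)) * Θ₂ t (x - Real.pi / 2) := by positivity
  linarith

lemma strictAntiOn_Θ₂_div_Θ₃ (ht : 0 < t) :
    StrictAntiOn (fun x => Θ₂ (2 * t) x / Θ₃ (2 * t) x) (Set.Icc 0 Real.pi) := by
  have ht2 : 0 < 2 * t := by positivity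
  have hd (x : ℝ) := (differentiable_Θ₂ ht2 x).hasDerivAt.div
    (differentiable_Θ₃ ht2 x).hasDerivAt (Θ₃_pos ht2 x).ne'
  refine strictAntiOn_of_deriv_neg (convex_Icc _ _)
    (fun x _ => (hd x).continuousAt.continuousWithinAt) fun x hx => ?_
  rw [interior_Icc] at hx
  have h := wronskian_Θ₂_Θ₃_pos ht hx
  have h3 := Θ₃_pos ht2 x
  refine (hd x).deriv.trans_lt (div_neg_of_neg_of_pos ?_ (by positivity))
  linarith

/-- Strict midpoint convexity of `ϑ₃' / ϑ₃`: by Schröter's identity the ratio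
`ϑ₃ (x + d) ϑ₃ (x - d) / ϑ₃ (x)²` is a Möbius function of `ϑ₂ / ϑ₃` at `2 x` with doubled `τ`,
hence increasing in `x`. -/
lemma two_mul_logDeriv_Θ₃_lt (ht : 0 < t) {x d : ℝ} (hx : x ∈ Set.Ioo 0 (Real.pi / 2))
    (hd : d ∈ Set.Ioo 0 (Real.pi / 2)) :
    2 * (deriv (Θ₃ t) x / Θ₃ t x) <
      deriv (Θ₃ t) (x + d) / Θ₃ t (x + d) + deriv (Θ₃ t) (x - d) / Θ₃ t (x - d) := by
  have ht2 : 0 < 2 * t := by positivity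
  -- derivative in `x` of Schröter's identity for the arguments `x + c` and `x - c`
  have hder (c : ℝ) : deriv (Θ₃ t) (x + c) * Θ₃ t (x - c) + Θ₃ t (x + c) * deriv (Θ₃ t) (x - c) =
      2 * deriv (Θ₃ (2 * t)) (2 * x) * Θ₃ (2 * t) (2 * c) +
        2 * deriv (Θ₂ (2 * t)) (2 * x) * Θ₂ (2 * t) (2 * c) := by
    have h1 : HasDerivAt (fun y => Θ₃ t (y + c)) (deriv (Θ₃ t) (x + c)) x :=
      HasDerivAt.comp_add_const x c (differentiable_Θ₃ ht _).hasDerivAt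
    have h2 : HasDerivAt (fun y => Θ₃ t (y - c)) (deriv (Θ₃ t) (x - c)) x :=
      HasDerivAt.comp_sub_const x c (differentiable_Θ₃ ht _).hasDerivAt
    have hid : HasDerivAt (fun y : ℝ => 2 * y) 2 x := by
      simpa using (hasDerivAt_id x).const_mul 2
    have h3 : HasDerivAt (fun y => Θ₃ (2 * t) (2 * y)) (deriv (Θ₃ (2 * t)) (2 * x) * 2) x :=
      HasDerivAt.comp x (differentiable_Θ₃ ht2 _).hasDerivAt hid
    have h4 : HasDerivAt (fun y => Θ₂ (2 * t) (2 * y)) (deriv (Θ₂ (2 * t)) (2 * x) * 2) x :=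
      HasDerivAt.comp x (differentiable_Θ₂ ht2 _).hasDerivAt hid
    have hr := (h3.mul_const (Θ₃ (2 * t) (2 * c))).add (h4.mul_const (Θ₂ (2 * t) (2 * c)))
    have hu := (h1.mul h2).unique (hr.congr_of_eventuallyEq (Eventually.of_forall fun y => by
      have := Θ₃_mul_Θ₃ ht (y + c) (y - c)
      rw [show y + c + (y - c) = 2 * y by ring, show y + c - (y - c) = 2 * c by ring] at this
      exact this))
    linarith
  have hval (c : ℝ) : Θ₃ t (x + c) * Θ₃ t (x - c) =
      Θ₃ (2 * t) (2 * x) * Θ₃ (2 * t) (2 * c) + Θ₂ (2 * t) (2 * x) * Θ₂ (2 * t) (2 * c) := by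
    have := Θ₃_mul_Θ₃ ht (x + c) (x - c)
    rwa [show x + c + (x - c) = 2 * x by ring, show x + c - (x - c) = 2 * c by ring] at this
  have e1 := hder d
  have e0 := hder 0
  have v1 := hval d
  have v0 := hval 0
  simp only [add_zero, sub_zero, mul_zero] at e0 v0
  have hw := wronskian_Θ₂_Θ₃_pos ht (x := 2 * x) ⟨by linarith [hx.1], by linarith [hx.2]⟩
  have p0 := Θ₃_pos ht2 0
  have pd := Θ₃_pos ht2 (2 * d)
  have hρ : 0 < Θ₃ (2 * t) (2 * d) * Θ₂ (2 * t) 0 - Θ₂ (2 * t) (2 * d) * Θ₃ (2 * t) 0 := by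
    have := strictAntiOn_Θ₂_div_Θ₃ ht (Set.left_mem_Icc.mpr Real.pi_pos.le)
      (show 2 * d ∈ Set.Icc 0 Real.pi from ⟨by linarith [hd.1], by linarith [hd.2]⟩)
      (by linarith [hd.1])
    simp only at this
    rw [div_lt_div_iff₀ pd p0] at this
    linarith
  have q := Θ₃_pos ht x
  have qp := Θ₃_pos ht (x + d)
  have qm := Θ₃_pos ht (x - d)
  rw [div_add_div _ _ qp.ne' qm.ne', e1, v1, show 2 * (deriv (Θ₃ t) x / Θ₃ t x) =
    (deriv (Θ₃ t) x * Θ₃ t x + Θ₃ t x * deriv (Θ₃ t) x) / (Θ₃ t x * Θ₃ t x) by field_simp; ring,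
    e0, v0, div_lt_div_iff₀ (v0 ▸ by positivity) (v1 ▸ by positivity)]
  linear_combination 2 * mul_pos hw hρ

lemma deriv_Θ₃_neg_of_mem_Ioo (ht : 0 < t) {x : ℝ} (hx : x ∈ Set.Ioo 0 (Real.pi / 2)) :
    deriv (Θ₃ t) x < 0 := by
  have hc : Continuous fun x => deriv (Θ₃ t) x / Θ₃ t x :=
    (continuous_deriv_Θ₃ ht).div (differentiable_Θ₃ ht).continuous fun x => (Θ₃_pos ht x).ne'
  have h := neg_of_midpoint_convex hc.continuousOn (a := 0) (b := Real.pi / 2)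
    (by simp [deriv_Θ₃_zero]) (by simp [deriv_Θ₃_pi_div_two])
    (fun x d hd h1 h2 => two_mul_logDeriv_Θ₃_lt ht ⟨by linarith, by linarith⟩
      ⟨hd, by linarith⟩) hx
  simpa [div_lt_iff₀ (Θ₃_pos ht x)] using h

lemma deriv_Θ₃_neg (ht : 0 < t) {x : ℝ} (hx : 0 < Real.sin (2 * x)) : deriv (Θ₃ t) x < 0 := by
  have hper : Function.Periodic (deriv (Θ₃ t)) Real.pi := fun y => by
    have h : deriv (fun y => Θ₃ t (y + Real.pi)) y = deriv (Θ₃ t) (y + Real.pi) :=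
      deriv_comp_add_const _ _ _
    simp only [Θ₃_add_pi] at h
    exact h.symm
  have hsper : Function.Periodic (fun x => Real.sin (2 * x)) Real.pi := fun y => by
    simp only [mul_add, Real.sin_add_two_pi]
  have hper2 : Function.Periodic (fun x => (deriv (Θ₃ t) x, Real.sin (2 * x))) Real.pi :=
    fun y => Prod.ext (hper y) (hsper y)
  obtain ⟨y, hy, hxy⟩ := hper2.exists_mem_Ico₀ Real.pi_pos x
  rw [Prod.mk.injEq] at hxy
  rw [hxy.2] at hx
  rw [hxy.1]
  refine deriv_Θ₃_neg_of_mem_Ioo ht ⟨lt_of_le_of_ne hy.1 ?_, ?_⟩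
  · rintro rfl
    simp at hx
  · by_contra! hge
    have := Real.sin_nonneg_of_nonneg_of_le_pi (x := 2 * y - Real.pi) (by linarith)
      (by linarith [hy.2])
    rw [Real.sin_sub_pi] at this
    linarith

/-! ### The coefficients of the two energies -/

lemma f_eq (ht : 0 < t) (φ : ℝ) :
    f (Complex.I * t) φ = ((Θ₂ t (φ / 2 - Real.pi / 2) / Θ₂ t (φ / 2) : ℝ) : ℂ) := by
  have h : theta1 (Complex.I * t) (φ / 2) = theta2 (Complex.I * t) (φ / 2 - Real.pi / 2) := by
    rw [theta2, sub_add_cancel]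
  rw [f, h, Complex.ofReal_div, ofReal_Θ₂ ht, ofReal_Θ₂ ht]
  push_cast
  rfl

lemma h_eq (ht : 0 < t) (lam α : ℝ) :
    h (Complex.I * t) lam α =
      ((Θ₃ t ((α - lam) / 2 + Real.pi / 2) / Θ₃ t ((α - lam) / 2) : ℝ) : ℂ) := by
  rw [h, Complex.ofReal_div, ofReal_Θ₃ ht, ofReal_Θ₃ ht, theta4]
  push_cast
  rfl

lemma g₀_eq (ht : 0 < t) (φ : ℝ) :
    g₀ (Complex.I * t) φ = ((-(1 / (Θ₃ t 0 * Θ₃ t (Real.pi / 2))) *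
      (deriv (Θ₂ t) (φ / 2) / Θ₂ t (φ / 2)) : ℝ) : ℂ) := by
  simp only [Complex.ofReal_mul, Complex.ofReal_neg, Complex.ofReal_div, Complex.ofReal_one,
    ofReal_Θ₃ ht, ofReal_Θ₂ ht, ofReal_deriv_Θ₂ ht]
  rw [g₀, theta4]
  push_cast
  rw [zero_add]

lemma h_add_pi (τ lam α : ℂ) : h τ lam (α + Real.pi) = (h τ lam α)⁻¹ := by
  rw [h, h, inv_div, theta4, theta4,
    show (α + Real.pi - lam) / 2 + Real.pi / 2 = (α - lam) / 2 + Real.pi by ring, theta3_add_pi,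
    show (α + Real.pi - lam) / 2 = (α - lam) / 2 + Real.pi / 2 by ring]

lemma Θ₂_ratio_pos (ht : 0 < t) {φ : ℝ} (hφ : 0 < Real.sin φ) :
    0 < Θ₂ t (φ / 2 - Real.pi / 2) / Θ₂ t (φ / 2) := by
  have hsc : 0 < Real.sin (φ / 2) * Real.cos (φ / 2) := by
    have := Real.sin_two_mul (φ / 2)
    rw [mul_div_cancel₀ φ two_ne_zero] at this
    linarith
  have h1 := Θ₂_sub_pi_div_two_mul_sin_pos ht (left_ne_zero_of_mul hsc.ne')
  have h2 := Θ₂_mul_cos_pos ht (right_ne_zero_of_mul hsc.ne')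
  have h3 : 0 < (Θ₂ t (φ / 2 - Real.pi / 2) * Θ₂ t (φ / 2)) *
      (Real.sin (φ / 2) * Real.cos (φ / 2)) := by
    have := mul_pos h1 h2
    linarith
  have h4 := pos_of_mul_pos_left h3 hsc.le
  exact div_pos_iff.mpr (mul_pos_iff.mp h4)

/-- The inequality `f < g₀`: the difference is a negative multiple of the logarithmic derivative of
`ϑ₃` at doubled `τ`. -/
lemma Θ₂_ratio_lt (ht : 0 < t) {φ : ℝ} (hφ : 0 < Real.sin φ) :
    Θ₂ t (φ / 2 - Real.pi / 2) / Θ₂ t (φ / 2) <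
      -(1 / (Θ₃ t 0 * Θ₃ t (Real.pi / 2))) * (deriv (Θ₂ t) (φ / 2) / Θ₂ t (φ / 2)) := by
  have ht2 : 0 < 2 * t := by positivity
  set x := φ / 2 with hx
  have hφx : φ = 2 * x := by rw [hx]; ring
  have hB' : deriv (Θ₃ (2 * t)) x < 0 := deriv_Θ₃_neg ht2 (hφx ▸ hφ)
  have hb : Θ₂ t x ≠ 0 := fun h0 => by
    have := Θ₂_ratio_pos ht hφ
    rw [← hx, h0, div_zero] at this
    exact this.false
  have hprod := Θ₂_mul_Θ₂_zero ht x
  have hprod' : deriv (Θ₂ t) x * Θ₂ t 0 =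
      2 * (deriv (Θ₂ (2 * t)) x * Θ₃ (2 * t) x + Θ₂ (2 * t) x * deriv (Θ₃ (2 * t)) x) := by
    have hl := (differentiable_Θ₂ ht x).hasDerivAt.mul_const (Θ₂ t 0)
    have hr := ((differentiable_Θ₂ ht2 x).hasDerivAt.mul
      (differentiable_Θ₃ ht2 x).hasDerivAt).const_mul 2
    exact hl.unique (hr.congr_of_eventuallyEq (Eventually.of_forall (Θ₂_mul_Θ₂_zero ht)))
  have hw := wronskian_Θ₂_Θ₃ ht x
  rw [neg_deriv_Θ₂_pi_div_two ht] at hw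
  have p1 := Θ₂_zero_pos ht
  have p3 := Θ₃_pos ht 0
  have p4 := Θ₃_pos ht (Real.pi / 2)
  have pB := Θ₃_pos ht2 x
  rw [← sub_pos]
  generalize Θ₂ t (x - Real.pi / 2) = s at hw ⊢
  have key : -(1 / (Θ₃ t 0 * Θ₃ t (Real.pi / 2))) * (deriv (Θ₂ t) x / Θ₂ t x) -
      s / Θ₂ t x =
      -(2 * deriv (Θ₃ (2 * t)) x) / (Θ₃ t 0 * Θ₃ t (Real.pi / 2) * Θ₃ (2 * t) x) := by
    rw [eq_div_iff (by positivity)]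
    field_simp
    apply mul_left_cancel₀ p1.ne'
    linear_combination -Θ₃ (2 * t) x * hprod' + Θ₃ (2 * t) x * hw +
      2 * deriv (Θ₃ (2 * t)) x * hprod
  rw [key]
  exact div_pos (by linarith) (by positivity)

end Real

/-! ### The quad contributions as quadratic forms -/

/-- The binary quadratic form `½ A x² + ½ B y² - C x y`. -/
noncomputable def binaryForm (A B C : ℝ) : QuadraticForm ℝ (ℝ × ℝ) :=
  (A / 2) • QuadraticMap.linMulLin (LinearMap.fst ℝ ℝ ℝ) (LinearMap.fst ℝ ℝ ℝ) +
    (B / 2) • QuadraticMap.linMulLin (LinearMap.snd ℝ ℝ ℝ) (LinearMap.snd ℝ ℝ ℝ) -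
    C • QuadraticMap.linMulLin (LinearMap.fst ℝ ℝ ℝ) (LinearMap.snd ℝ ℝ ℝ)

lemma binaryForm_apply (A B C x y : ℝ) :
    binaryForm A B C (x, y) = A / 2 * x ^ 2 + B / 2 * y ^ 2 - C * x * y := by
  simp [binaryForm]
  ring

lemma binaryForm_posDef {A C : ℝ} (hC : 0 < C) (h : C < A) : (binaryForm A A C).PosDef := by
  rintro ⟨x, y⟩ hxy
  rw [binaryForm_apply]
  have hne : 0 < x ^ 2 + y ^ 2 := by
    by_contra! h0
    have hx : x = 0 := by nlinarith [sq_nonneg x, sq_nonneg y]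
    have hy : y = 0 := by nlinarith [sq_nonneg x, sq_nonneg y]
    exact hxy (by rw [hx, hy]; rfl)
  have h1 := mul_pos (sub_pos.mpr h) hne
  have h2 := mul_nonneg hC.le (sq_nonneg (x - y))
  linarith

lemma exists_f_eq {t : ℝ} (ht : 0 < t) (q : RhombicQuad) :
    ∃ a : ℝ, 0 < a ∧ (a : ℂ) = f (Complex.I * t) (q.α - q.β) :=
  ⟨_, Θ₂_ratio_pos ht q.oriented, by rw [← f_eq ht, Complex.ofReal_sub]⟩

lemma exists_h_eq {t : ℝ} (ht : 0 < t) (lam α : ℝ) :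
    ∃ b : ℝ, 0 < b ∧ (b : ℂ) = h (Complex.I * t) lam α :=
  ⟨_, div_pos (Θ₃_pos ht _) (Θ₃_pos ht _), (h_eq ht lam α).symm⟩

lemma exists_gTerm_form {t : ℝ} (ht : 0 < t) (lam : ℝ) (q : RhombicQuad) :
    ∃ Q : QuadraticForm ℝ (ℝ × ℝ),
      (∀ x y : ℝ, ((Q (x, y) : ℝ) : ℂ) = gTerm (Complex.I * t) lam q x y) ∧
      Q ≠ 0 ∧ (∀ v : ℝ × ℝ, 0 ≤ Q v) ∧
      ∃ a κ : ℝ, 0 < a ∧ 0 < κ ∧ (a : ℂ) = f (Complex.I * t) (q.α - q.β) ∧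
        (κ : ℂ) = h (Complex.I * t) lam q.α * h (Complex.I * t) lam q.β ∧
        ∀ x y : ℝ, Q (x, y) = a / (2 * κ) * (κ * x - y) ^ 2 := by
  obtain ⟨a, ha, hfa⟩ := exists_f_eq ht q
  obtain ⟨b, hb, hhb⟩ := exists_h_eq ht lam q.α
  obtain ⟨c, hc, hhc⟩ := exists_h_eq ht lam q.β
  have hsq (x y : ℝ) : binaryForm (a * (b * c)) (a / (b * c)) a (x, y) =
      a / (2 * (b * c)) * (b * c * x - y) ^ 2 := by
    rw [binaryForm_apply]
    field_simp
    ring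
  refine ⟨binaryForm (a * (b * c)) (a / (b * c)) a, fun x y => ?_, fun h0 => ?_, fun ⟨x, y⟩ => ?_,
    a, b * c, ha, mul_pos hb hc, hfa, by rw [← hhb, ← hhc, Complex.ofReal_mul], hsq⟩
  · rw [binaryForm_apply, gTerm, g, g, h_add_pi, h_add_pi, add_sub_add_right_eq_sub, ← hfa, ← hhb,
      ← hhc]
    push_cast
    rw [div_eq_mul_inv (a : ℂ) (b * c : ℂ), mul_inv]
    ring
  · have h1 := hsq 0 1
    rw [h0, zero_apply] at h1
    have : 0 < a / (2 * (b * c)) * (b * c * 0 - 1) ^ 2 := by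
      rw [mul_zero, zero_sub, neg_one_sq, mul_one]
      positivity
    exact this.ne h1
  · rw [hsq]
    positivity

lemma exists_g₀Term_form {t : ℝ} (ht : 0 < t) (q : RhombicQuad) :
    ∃ Q : QuadraticForm ℝ (ℝ × ℝ),
      (∀ x y : ℝ, ((Q (x, y) : ℝ) : ℂ) = g₀Term (Complex.I * t) q x y) ∧ Q.PosDef := by
  refine ⟨_, fun x y => ?_,
    binaryForm_posDef (Θ₂_ratio_pos ht q.oriented) (Θ₂_ratio_lt ht q.oriented)⟩
  rw [binaryForm_apply, g₀Term, ← Complex.ofReal_sub, f_eq ht, g₀_eq ht]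
  push_cast
  ring

end IsoradialDirichlet

theorem theorem5 (τ₀ : ℝ) (hτ₀ : 0 < τ₀) (lam : ℝ) (G : IsoradialDirichlet.RhombicQuadGraph) :
    -- the energy built from `g` and `f`
    (∃ Q : IsoradialDirichlet.RhombicQuad → QuadraticForm ℝ (ℝ × ℝ),
      (∀ q ∈ G.faces, ∀ x y : ℝ,
        ((Q q (x, y) : ℝ) : ℂ) = IsoradialDirichlet.gTerm (Complex.I * τ₀) lam q x y) ∧
      (∀ F : Finset IsoradialDirichlet.RhombicQuad, (F : Set IsoradialDirichlet.RhombicQuad) ⊆ G.faces →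
        ∀ x : ℂ → ℝ,
          IsoradialDirichlet.gEnergy (Complex.I * τ₀) lam F (fun v => (x v : ℂ)) =
            ((∑ q ∈ F, Q q (x q.x₀, x q.x₁₂) : ℝ) : ℂ)) ∧
      (∀ q ∈ G.faces,
        Q q ≠ 0 ∧ (∀ v : ℝ × ℝ, 0 ≤ Q q v) ∧
        ∃ a κ : ℝ, 0 < a ∧ 0 < κ ∧
          (a : ℂ) = IsoradialDirichlet.f (Complex.I * τ₀) (q.α - q.β) ∧
          (κ : ℂ) = IsoradialDirichlet.h (Complex.I * τ₀) lam q.α *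
            IsoradialDirichlet.h (Complex.I * τ₀) lam q.β ∧
          ∀ x y : ℝ, Q q (x, y) = a / (2 * κ) * (κ * x - y) ^ 2)) ∧
    -- the energy built from `g₀` and `f`
    (∃ Q : IsoradialDirichlet.RhombicQuad → QuadraticForm ℝ (ℝ × ℝ),
      (∀ q ∈ G.faces, ∀ x y : ℝ,
        ((Q q (x, y) : ℝ) : ℂ) = IsoradialDirichlet.g₀Term (Complex.I * τ₀) q x y) ∧
      (∀ F : Finset IsoradialDirichlet.RhombicQuad, (F : Set IsoradialDirichlet.RhombicQuad) ⊆ G.faces →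
        ∀ x : ℂ → ℝ,
          IsoradialDirichlet.g₀Energy (Complex.I * τ₀) F (fun v => (x v : ℂ)) =
            ((∑ q ∈ F, Q q (x q.x₀, x q.x₁₂) : ℝ) : ℂ)) ∧
      (∀ q ∈ G.faces, (Q q).PosDef)) := by
  choose Q hQ hQ' using IsoradialDirichlet.exists_gTerm_form hτ₀ lam
  choose P hP hP' using IsoradialDirichlet.exists_g₀Term_form hτ₀
  refine ⟨⟨Q, fun q _ => hQ q, fun F _ x => ?_, fun q _ => hQ' q⟩,
    ⟨P, fun q _ => hP q, fun F _ x => ?_, fun q _ => hP' q⟩⟩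
  · rw [Complex.ofReal_sum, IsoradialDirichlet.gEnergy]
    exact Finset.sum_congr rfl fun q _ => (hQ q _ _).symm
  · rw [Complex.ofReal_sum, IsoradialDirichlet.g₀Energy]
    exact Finset.sum_congr rfl fun q _ => (hP q _ _).symm
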